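/- Let $d\ge 2$ and consider a bipartite system $AB$ with $\mathcal H_A=\mathcal H_B=\mathbb C^d$. For a system of dimension $D$ let $\Phi_q[X]=qX+(1-q)\,\mathrm{tr}(X)\,I/D$ denote the depolarizing map; $\Phi_q$ without superscript acts on $\mathbb C^d$, and $\Phi_q^{AB}$ (with $D=d^2$) is the global depolarizing map on $AB$. Let $\Lambda_{st}$ be the linear map on operators of $AB$ that is diagonal with respect to a product $\{\gamma_j\otimes\gamma_k\}_{j,k=0}^{d^2-1}$ of operator bases in which $\gamma_0\propto I$ and $\gamma_j$ is traceless for $j\ge1$, with eigenvalue $1$ on $\gamma_0\otimes\gamma_0$, eigenvalue $s$ on $\gamma_0\otimes\gamma_k$ and $\gamma_j\otimes\gamma_0$, and eigenvalue $t$ on $\gamma_j\otimes\gamma_k$ ($j,k\ge 1$). Put $$q_{\rm EA}=\frac{d+2}{(d+1)(d^2-d+2)} .$$ A channel on $AB$ is entanglement-annihilating if it sends every state of $AB$ to a state that is separable with respect to $A|B$; a channel $\Phi$ on a system $S$ is entanglement-breaking if $(\Phi\otimes\mathrm{Id}^E)[\omega]$ is separable with respect to $S|E$ for every environment $E$ and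 every state $\omega$ of $SE$. Then: 1. For every $q$ with $-\frac1{d^4-1}\le q\le q_{\rm EA}$, the global depolarizing map $\Phi_q^{AB}$ is an entanglement-annihilating channel, and it has the resolution $$\Phi_q^{AB}=\tfrac12\bigl(\Phi_p\otimes\mathrm{Id}+\mathrm{Id}\otimes\Phi_p\bigr)\circ\Lambda_{st},\qquad p=\frac1{d+1},\quad s=\frac{q}{q_{\rm EA}}\cdot\frac{2}{d^2-d+2},\quad t=\frac{d+2}{2}\,s,$$ in which $\Phi_p$ is an entanglement-breaking channel and $\Lambda_{st}$ is a positive map. 2. In particular, at the threshold $q=q_{\rm EA}$ this resolution holds, with $\Phi_p$ entanglement-breaking and $\Lambda_{st}$ positive, for $p=\frac1{d+1}$, $s=\frac{2}{d^2-d+2}$ and $t=\frac{(d+2)s}{2}$. -/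

import Mathlib

open scoped ComplexOrder Kronecker

noncomputable section

namespace EAChannel

/-- Linear maps between matrix algebras; a finite-dimensional system with a chosen orthonormal
basis `m` has operator algebra `Matrix m m ℂ`, and `m × n` indexes the composite system. -/
abbrev Superop (m n : Type*) : Type _ := Matrix m m ℂ →ₗ[ℂ] Matrix n n ℂ

/-- Density operators: positive with unit trace. -/
def IsState {n : Type*} [Fintype n] (ρ : Matrix n n ℂ) : Prop :=
  ρ.PosSemidef ∧ ρ.trace = 1

/-- Separability with respect to the partition `m | n`: the operator is a (finite) convex
combination of products of states. -/
def IsSeparable {m n : Type*} [Fintype m] [Fintype n] (ρ : Matrix (m × n) (m × n) ℂ) : Prop :=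
  ∃ (r : ℕ) (w : Fin r → ℝ) (σ : Fin r → Matrix m m ℂ) (τ : Fin r → Matrix n n ℂ),
    (∀ j, 0 ≤ w j) ∧ ∑ j, w j = 1 ∧ (∀ j, IsState (σ j)) ∧ (∀ j, IsState (τ j)) ∧
      ρ = ∑ j, (w j : ℂ) • (σ j ⊗ₖ τ j)

/-- `Φ ⊗ Id`: `Φ` is applied to the first tensor factor. -/
def tensorId {m m' : Type*} (Φ : Superop m m') (n : Type*) : Superop (m × n) (m' × n) where
  toFun X := Matrix.of fun x y => Φ (Matrix.of fun i j => X (i, x.2) (j, y.2)) x.1 y.1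
  map_add' X Y := by
    ext x y
    exact congrFun (congrFun (Φ.map_add (Matrix.of fun i j => X (i, x.2) (j, y.2))
      (Matrix.of fun i j => Y (i, x.2) (j, y.2))) x.1) y.1
  map_smul' c X := by
    ext x y
    exact congrFun (congrFun (Φ.map_smul c (Matrix.of fun i j => X (i, x.2) (j, y.2))) x.1) y.1

/-- `Id ⊗ Φ`: `Φ` is applied to the second tensor factor. -/
def idTensor {n n' : Type*} (m : Type*) (Φ : Superop n n') : Superop (m × n) (m × n') where
  toFun X := Matrix.of fun x y => Φ (Matrix.of fun i j => X (x.1, i) (y.1, j)) x.2 y.2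
  map_add' X Y := by
    ext x y
    exact congrFun (congrFun (Φ.map_add (Matrix.of fun i j => X (x.1, i) (y.1, j))
      (Matrix.of fun i j => Y (x.1, i) (y.1, j))) x.2) y.2
  map_smul' c X := by
    ext x y
    exact congrFun (congrFun (Φ.map_smul c (Matrix.of fun i j => X (x.1, i) (y.1, j))) x.2) y.2

theorem tensorId_kronecker {m m' n : Type*} (Φ : Superop m m')
    (X : Matrix m m ℂ) (Y : Matrix n n ℂ) : tensorId Φ n (X ⊗ₖ Y) = Φ X ⊗ₖ Y := by
  ext x y
  have h : (Matrix.of fun i j => (X ⊗ₖ Y) (i, x.2) (j, y.2)) = Y x.2 y.2 • X := by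
    ext i j
    simp [mul_comm]
  change Φ (Matrix.of fun i j => (X ⊗ₖ Y) (i, x.2) (j, y.2)) x.1 y.1 = _
  rw [h, map_smul]
  simp [mul_comm]

theorem idTensor_kronecker {m n n' : Type*} (Φ : Superop n n')
    (X : Matrix m m ℂ) (Y : Matrix n n ℂ) : idTensor m Φ (X ⊗ₖ Y) = X ⊗ₖ Φ Y := by
  ext x y
  have h : (Matrix.of fun i j => (X ⊗ₖ Y) (x.1, i) (y.1, j)) = X x.1 y.1 • Y := by
    ext i j
    simp
  change Φ (Matrix.of fun i j => (X ⊗ₖ Y) (x.1, i) (y.1, j)) x.2 y.2 = _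
  rw [h, map_smul]
  simp

/-- A positive map sends positive operators to positive operators. -/
def IsPositiveMap {m n : Type*} (Λ : Superop m n) : Prop :=
  ∀ X : Matrix m m ℂ, X.PosSemidef → (Λ X).PosSemidef

/-- Complete positivity: `Φ ⊗ Id` is positive for every finite-dimensional ancilla. -/
def IsCP {m n : Type*} (Φ : Superop m n) : Prop :=
  ∀ k : ℕ, IsPositiveMap (tensorId Φ (Fin k))

/-- Quantum channels: completely positive trace-preserving linear maps. -/
def IsChannel {m n : Type*} [Fintype m] [Fintype n] (Φ : Superop m n) : Prop :=
  IsCP Φ ∧ ∀ X, (Φ X).trace = X.trace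

/-- Entanglement-annihilating channel on a bipartite system: a channel whose output is separable
for every input state. -/
def IsEntanglementAnnihilating {a b : Type*} [Fintype a] [Fintype b]
    (Φ : Superop (a × b) (a × b)) : Prop :=
  IsChannel Φ ∧ ∀ ρ, IsState ρ → IsSeparable (Φ ρ)

/-- Entanglement-breaking channel: a channel that disentangles its system from every environment,
whatever the joint input state. -/
def IsEntanglementBreaking {m : Type*} [Fintype m] (Φ : Superop m m) : Prop :=
  IsChannel Φ ∧ ∀ (k : ℕ) (ω : Matrix (m × Fin k) (m × Fin k) ℂ),
    IsState ω → IsSeparable (tensorId Φ (Fin k) ω)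

/-- The trace map `X ↦ tr(X) I / D`, where `D` is the dimension of the system. -/
def traceMap (n : Type*) [Fintype n] [DecidableEq n] : Superop n n :=
  (Matrix.traceLinearMap n ℂ ℂ).smulRight ((Fintype.card n : ℂ)⁻¹ • (1 : Matrix n n ℂ))

/-- The depolarizing map `Φ_q = q Id + (1 - q) Tr`. For `n = a × b` it is the global depolarizing
map of the bipartite system. -/
def depolarizing (n : Type*) [Fintype n] [DecidableEq n] (q : ℝ) : Superop n n :=
  (q : ℂ) • LinearMap.id + ((1 - q : ℝ) : ℂ) • traceMap n

/-- The map `Λ_{st}` on a bipartite system: with `P` the trace map (the projection onto multiples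
of the identity along the traceless operators), it has eigenvalue `1` on the range of `P ⊗ P`,
`s` on the ranges of `P ⊗ (Id - P)` and `(Id - P) ⊗ P`, and `t` on that of
`(Id - P) ⊗ (Id - P)`. -/
def lambdaMap (a b : Type*) [Fintype a] [DecidableEq a] [Fintype b] [DecidableEq b] (s t : ℝ) :
    Superop (a × b) (a × b) :=
  tensorId (traceMap a) b ∘ₗ idTensor a (traceMap b)
    + (s : ℂ) • (tensorId (traceMap a) b ∘ₗ idTensor a (LinearMap.id - traceMap b)
        + tensorId (LinearMap.id - traceMap a) b ∘ₗ idTensor a (traceMap b))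
    + (t : ℂ) • (tensorId (LinearMap.id - traceMap a) b ∘ₗ
        idTensor a (LinearMap.id - traceMap b))

/-- `Λ_{st}` is diagonal, with entries `1`, `s`, `s`, `t`, in any product operator basis whose
local bases consist of the identity and of traceless operators. -/
theorem lambdaMap_diagonal {a b : Type*} [Fintype a] [DecidableEq a] [Nonempty a]
    [Fintype b] [DecidableEq b] [Nonempty b] (s t : ℝ)
    (X : Matrix a a ℂ) (hX : X.trace = 0) (Y : Matrix b b ℂ) (hY : Y.trace = 0) :
    lambdaMap a b s t ((1 : Matrix a a ℂ) ⊗ₖ (1 : Matrix b b ℂ)) = 1 ⊗ₖ 1 ∧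
    lambdaMap a b s t (1 ⊗ₖ Y) = (s : ℂ) • (1 ⊗ₖ Y) ∧
    lambdaMap a b s t (X ⊗ₖ 1) = (s : ℂ) • (X ⊗ₖ 1) ∧
    lambdaMap a b s t (X ⊗ₖ Y) = (t : ℂ) • (X ⊗ₖ Y) := by
  have e1 : traceMap a 1 = 1 := by simp [traceMap, smul_smul]
  have e2 : traceMap b 1 = 1 := by simp [traceMap, smul_smul]
  have e3 : traceMap a X = 0 := by simp [traceMap, hX]
  have e4 : traceMap b Y = 0 := by simp [traceMap, hY]
  refine ⟨?_, ?_, ?_, ?_⟩ <;>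
    simp only [lambdaMap, LinearMap.add_apply, LinearMap.smul_apply, LinearMap.comp_apply,
      LinearMap.sub_apply, LinearMap.id_apply, tensorId_kronecker, idTensor_kronecker,
      e1, e2, e3, e4, sub_self, sub_zero, Matrix.zero_kronecker, Matrix.kronecker_zero,
      map_zero, smul_zero, add_zero, zero_add]

/-- The threshold `(d + 2) / ((d + 1) (d² - d + 2))`. -/
def globalThreshold (d : ℕ) : ℝ :=
  ((d : ℝ) + 2) / (((d : ℝ) + 1) * ((d : ℝ) ^ 2 - d + 2))

/-- The map `½ (Φ_p ⊗ Id + Id ⊗ Φ_p) ∘ Λ_{st}` on a `d × d` system. -/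
def resolutionMap (d : ℕ) (p s t : ℝ) : Superop (Fin d × Fin d) (Fin d × Fin d) :=
  ((1 / 2 : ℝ) : ℂ) • ((tensorId (depolarizing (Fin d) p) (Fin d)
    + idTensor (Fin d) (depolarizing (Fin d) p)) ∘ₗ lambdaMap (Fin d) (Fin d) s t)

end EAChannel

end

noncomputable section

namespace EAChannel

variable {m n m' n' : Type*}

/-! The choice `p = 1/(d+1)` makes `Φ_p` proportional to `X ↦ X + tr(X) I`, which is a nonnegative
sum of maps `X ↦ (v† X v) v v†`. Applied to either factor of a positive operator, `Φ_p` therefore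
gives a separable one. Once `Λ_{st}` is positive, both terms of the resolution have separable
output, and so does their average (`mem_sepCone_resolutionMap`).

The resolution is a comparison of eigenvalues: `(1+p)s/2 = q` on operators traceless in one factor
and proportional to the identity in the other, and `pt = q` on products of traceless operators.
Together they force `t = (d+2)s/2`.

Positivity of `Λ_{st}` depends on the sign of `q`. For `q ≥ 0` it is a combination of the double
reduction map, the identity and `X ↦ tr(X) I`; the last coefficient is nonnegative exactly up to the
threshold. For `q ≤ 0` another combination works, with room to spare. The lower bound on `q` is also
what complete positivity of `Φ_q^{AB}` needs. -/

/-- Superoperators on a composite system agree if they agree on products. -/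
theorem superop_ext [Finite m] [Finite n] {Φ Ψ : Superop (m × n) m'}
    (h : ∀ (X : Matrix m m ℂ) (Y : Matrix n n ℂ), Φ (X ⊗ₖ Y) = Ψ (X ⊗ₖ Y)) : Φ = Ψ := by
  classical
  refine Matrix.ext_linearMap ℂ fun x y => LinearMap.ext_ring ?_
  have := h (Matrix.single x.1 y.1 1) (Matrix.single x.2 y.2 1)
  simpa [Matrix.single_kronecker_single] using this

/-! ### Operator-sum representations and complete positivity -/

/-- Conjugation `X ↦ K X K†`. -/
def conjMap [Fintype m] (K : Matrix n m ℂ) : Superop m n where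
  toFun X := K * X * K.conjTranspose
  map_add' X Y := by rw [Matrix.mul_add, Matrix.add_mul]
  map_smul' c X := by simp

theorem conjMap_apply [Fintype m] (K : Matrix n m ℂ) (X : Matrix m m ℂ) :
    conjMap K X = K * X * K.conjTranspose := rfl

theorem isPositiveMap_conjMap [Fintype m] [Finite n] (K : Matrix n m ℂ) :
    IsPositiveMap (conjMap K) := fun _ hX => hX.mul_mul_conjTranspose_same K

theorem tensorId_conjMap [Fintype m] [Fintype n] [DecidableEq n] (K : Matrix m' m ℂ) :
    tensorId (conjMap K) n = conjMap (K ⊗ₖ (1 : Matrix n n ℂ)) := by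
  refine superop_ext fun X Y => ?_
  simp [tensorId_kronecker, conjMap_apply, Matrix.conjTranspose_kronecker,
    ← Matrix.mul_kronecker_mul]

theorem idTensor_conjMap [Fintype m] [DecidableEq m] [Fintype n] (K : Matrix n' n ℂ) :
    idTensor m (conjMap K) = conjMap ((1 : Matrix m m ℂ) ⊗ₖ K) := by
  refine superop_ext fun X Y => ?_
  simp [idTensor_kronecker, conjMap_apply, Matrix.conjTranspose_kronecker,
    ← Matrix.mul_kronecker_mul]

/-- The cone of superoperators with an operator-sum representation. -/
def krausCone (m n : Type*) [Fintype m] : AddSubmonoid (Superop m n) :=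
  AddSubmonoid.closure (Set.range conjMap)

theorem conjMap_mem_krausCone [Fintype m] (K : Matrix n m ℂ) : conjMap K ∈ krausCone m n :=
  AddSubmonoid.subset_closure ⟨K, rfl⟩

theorem id_mem_krausCone [Fintype m] [DecidableEq m] :
    (LinearMap.id : Superop m m) ∈ krausCone m m := by
  convert conjMap_mem_krausCone (1 : Matrix m m ℂ)
  ext1 X
  simp [conjMap_apply]

theorem smul_mem_krausCone [Fintype m] {c : ℝ} (hc : 0 ≤ c) {Φ : Superop m n}
    (h : Φ ∈ krausCone m n) : (c : ℂ) • Φ ∈ krausCone m n := by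
  induction h using AddSubmonoid.closure_induction with
  | mem _ h =>
    obtain ⟨K, rfl⟩ := h
    convert conjMap_mem_krausCone (((√c : ℝ) : ℂ) • K)
    ext1 X
    simp only [conjMap_apply, LinearMap.smul_apply, Matrix.conjTranspose_smul, Matrix.smul_mul,
      Matrix.mul_smul, smul_smul]
    rw [RCLike.star_def, Complex.conj_ofReal, ← Complex.ofReal_mul, Real.mul_self_sqrt hc]
  | zero => simp
  | add _ _ _ _ h1 h2 =>
    rw [smul_add]
    exact add_mem h1 h2

theorem isPositiveMap_of_mem_krausCone [Fintype m] [Finite n] {Φ : Superop m n}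
    (h : Φ ∈ krausCone m n) : IsPositiveMap Φ := by
  induction h using AddSubmonoid.closure_induction with
  | mem _ h =>
    obtain ⟨K, rfl⟩ := h
    exact isPositiveMap_conjMap K
  | zero => exact fun _ _ => Matrix.PosSemidef.zero
  | add _ _ _ _ h1 h2 => exact fun X hX => (h1 X hX).add (h2 X hX)

theorem tensorId_mem_krausCone [Fintype m] [Fintype n] {Φ : Superop m m'}
    (h : Φ ∈ krausCone m m') : tensorId Φ n ∈ krausCone (m × n) (m' × n) := by
  classical
  induction h using AddSubmonoid.closure_induction with
  | mem _ h =>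
    obtain ⟨K, rfl⟩ := h
    rw [tensorId_conjMap]
    exact conjMap_mem_krausCone _
  | zero => exact zero_mem _
  | add _ _ _ _ h1 h2 => exact add_mem h1 h2

theorem idTensor_mem_krausCone [Fintype m] [Fintype n] {Φ : Superop n n'}
    (h : Φ ∈ krausCone n n') : idTensor m Φ ∈ krausCone (m × n) (m × n') := by
  classical
  induction h using AddSubmonoid.closure_induction with
  | mem _ h =>
    obtain ⟨K, rfl⟩ := h
    rw [idTensor_conjMap]
    exact conjMap_mem_krausCone _
  | zero => exact zero_mem _
  | add _ _ _ _ h1 h2 => exact add_mem h1 h2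

theorem isCP_of_mem_krausCone [Fintype m] [Finite n] {Φ : Superop m n}
    (h : Φ ∈ krausCone m n) : IsCP Φ := fun _ =>
  isPositiveMap_of_mem_krausCone (tensorId_mem_krausCone h)

/-- The map `X ↦ tr(X) I`. -/
def traceOne (n : Type*) [Fintype n] [DecidableEq n] : Superop n n :=
  (Matrix.traceLinearMap n ℂ ℂ).smulRight 1

theorem traceOne_apply [Fintype n] [DecidableEq n] (X : Matrix n n ℂ) :
    traceOne n X = X.trace • 1 := rfl

theorem sum_conjMap_single [Fintype n] [DecidableEq n] :
    ∑ i, ∑ j, conjMap (Matrix.single i j (1 : ℂ)) = traceOne n := by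
  ext1 X
  ext a b
  simp [LinearMap.sum_apply, conjMap_apply, Matrix.sum_apply, traceOne_apply, Matrix.single_apply,
    Matrix.one_apply, Matrix.trace, ite_and, eq_comm]

theorem traceOne_mem_krausCone [Fintype n] [DecidableEq n] : traceOne n ∈ krausCone n n := by
  rw [← sum_conjMap_single]
  exact sum_mem fun _ _ => sum_mem fun _ _ => conjMap_mem_krausCone _

/-- The map `X ↦ tr(X) I - Xᵀ`. -/
def wernerHolevo (n : Type*) [Fintype n] [DecidableEq n] : Superop n n :=
  traceOne n - (Matrix.transposeLinearEquiv n n ℂ ℂ).toLinearMap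

theorem wernerHolevo_apply [Fintype n] [DecidableEq n] (X : Matrix n n ℂ) :
    wernerHolevo n X = X.trace • 1 - X.transpose := rfl

/-- The Kraus operators are the antisymmetric matrix units; each unordered pair occurs twice, hence
the factor one half. -/
theorem wernerHolevo_eq [Fintype n] [DecidableEq n] :
    wernerHolevo n = ((1 / 2 : ℝ) : ℂ) • ∑ i, ∑ j,
      conjMap (Matrix.single i j (1 : ℂ) - Matrix.single j i 1) := by
  ext1 X
  ext a b
  simp [LinearMap.sum_apply, conjMap_apply, Matrix.sum_apply, wernerHolevo_apply,
    Matrix.sub_mul, Matrix.mul_sub, Finset.sum_sub_distrib, Matrix.single_apply,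
    Matrix.one_apply, Matrix.trace, ite_and, eq_comm]
  ring

theorem wernerHolevo_mem_krausCone [Fintype n] [DecidableEq n] :
    wernerHolevo n ∈ krausCone n n := by
  rw [wernerHolevo_eq]
  exact smul_mem_krausCone (by norm_num)
    (sum_mem fun _ _ => sum_mem fun _ _ => conjMap_mem_krausCone _)

/-- Domination of the identity map by `D tr(·) I` in the completely positive order. -/
theorem card_smul_traceOne_sub_id_mem_krausCone [Fintype n] [DecidableEq n] :
    ((Fintype.card n : ℝ) : ℂ) • traceOne n - LinearMap.id ∈ krausCone n n := by
  -- Since the diagonal units sum to the identity matrix, the first sum equals `D diag(X) - X`; the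
  -- off-diagonal units contribute `D (tr(X) I - diag(X))`.
  have key : ((Fintype.card n : ℝ) : ℂ) • traceOne n - LinearMap.id =
      ((1 / 2 : ℝ) : ℂ) • ∑ i, ∑ j,
        conjMap (Matrix.single i i (1 : ℂ) - Matrix.single j j 1) +
      ((Fintype.card n : ℝ) : ℂ) • ∑ i : n, ∑ j : n,
        if i = j then 0 else conjMap (Matrix.single i j (1 : ℂ)) := by
    have h : ∑ i : n, ∑ j : n, (if i = j then 0 else conjMap (Matrix.single i j (1 : ℂ))) =
        traceOne n - ∑ i : n, conjMap (Matrix.single i i (1 : ℂ)) := by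
      rw [← sum_conjMap_single, ← Finset.sum_sub_distrib]
      refine Finset.sum_congr rfl fun i _ => ?_
      rw [Finset.sum_ite, Finset.sum_const_zero, zero_add, Finset.filter_ne,
        Finset.sum_erase_eq_sub (Finset.mem_univ i)]
    rw [h]
    ext1 X
    ext a b
    simp [LinearMap.sum_apply, conjMap_apply, Matrix.sum_apply, traceOne_apply,
      Matrix.sub_mul, Matrix.mul_sub, Finset.sum_sub_distrib, Matrix.single_apply,
      Matrix.one_apply, ite_and, Matrix.sum_single_eq_diagonal, Matrix.diagonal_apply, eq_comm,
      -nsmul_eq_mul, Matrix.smul_apply]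
    simp only [nsmul_eq_mul]
    split_ifs with hab
    · subst hab
      ring
    · ring
  rw [key]
  refine add_mem (smul_mem_krausCone (by norm_num)
    (sum_mem fun _ _ => sum_mem fun _ _ => conjMap_mem_krausCone _))
    (smul_mem_krausCone (by positivity) (sum_mem fun _ _ => sum_mem fun _ _ => ?_))
  split_ifs
  · exact zero_mem _
  · exact conjMap_mem_krausCone _

theorem depolarizing_eq [Fintype n] [DecidableEq n] (q : ℝ) :
    depolarizing n q = (q : ℂ) • LinearMap.id +
      (((1 - q) / Fintype.card n : ℝ) : ℂ) • traceOne n := by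
  ext1 X
  simp only [depolarizing, traceMap, traceOne, LinearMap.add_apply, LinearMap.smul_apply,
    LinearMap.smulRight_apply, smul_smul]
  push_cast
  congr 2
  ring

theorem depolarizing_trace [Fintype n] [DecidableEq n] [Nonempty n] (q : ℝ) (X : Matrix n n ℂ) :
    (depolarizing n q X).trace = X.trace := by
  have : (Fintype.card n : ℂ) ≠ 0 := by simp
  simp only [depolarizing_eq, traceOne_apply, LinearMap.add_apply, LinearMap.smul_apply,
    LinearMap.id_apply, Matrix.trace_add, Matrix.trace_smul, Matrix.trace_one, smul_eq_mul]
  push_cast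
  field_simp
  ring

theorem isChannel_depolarizing [Fintype n] [DecidableEq n] [Nontrivial n] {q : ℝ}
    (h0 : -1 / ((Fintype.card n : ℝ) ^ 2 - 1) ≤ q) (h1 : q ≤ 1) :
    IsChannel (depolarizing n q) := by
  refine ⟨isCP_of_mem_krausCone ?_, depolarizing_trace q⟩
  have hD : (1 : ℝ) < Fintype.card n := by exact_mod_cast Fintype.one_lt_card
  rcases le_or_gt 0 q with hq | hq
  · rw [depolarizing_eq]
    exact add_mem (smul_mem_krausCone hq id_mem_krausCone)
      (smul_mem_krausCone (div_nonneg (by linarith) (by linarith)) traceOne_mem_krausCone)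
  -- For negative `q` the identity term is absorbed in `D tr(·) I - Id`. The trace coefficient left
  -- over is `(1 + q(D² - 1))/D`, nonnegative by the lower bound on `q`.
  · have key : depolarizing n q =
        ((-q : ℝ) : ℂ) • (((Fintype.card n : ℝ) : ℂ) • traceOne n - LinearMap.id) +
        (((1 - q) / Fintype.card n + q * Fintype.card n : ℝ) : ℂ) • traceOne n := by
      rw [depolarizing_eq]
      push_cast
      module
    rw [key]
    refine add_mem (smul_mem_krausCone (by linarith) card_smul_traceOne_sub_id_mem_krausCone)
      (smul_mem_krausCone ?_ traceOne_mem_krausCone)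
    rw [div_le_iff₀ (by nlinarith)] at h0
    have : (1 - q) / Fintype.card n + q * Fintype.card n =
        (1 - q + q * (Fintype.card n : ℝ) ^ 2) / Fintype.card n := by
      field_simp
    rw [this]
    exact div_nonneg (by linarith) (by linarith)

/-! ### Separable operators -/

/-- The cone of unnormalized separable operators. -/
def sepCone (m n : Type*) : AddSubmonoid (Matrix (m × n) (m × n) ℂ) :=
  AddSubmonoid.closure {ρ | ∃ (A : Matrix m m ℂ) (B : Matrix n n ℂ),
    A.PosSemidef ∧ B.PosSemidef ∧ ρ = A ⊗ₖ B}

theorem kronecker_mem_sepCone {A : Matrix m m ℂ} {B : Matrix n n ℂ} (hA : A.PosSemidef)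
    (hB : B.PosSemidef) : A ⊗ₖ B ∈ sepCone m n :=
  AddSubmonoid.subset_closure ⟨A, B, hA, hB, rfl⟩

theorem smul_mem_sepCone {c : ℝ} (hc : 0 ≤ c) {ρ : Matrix (m × n) (m × n) ℂ}
    (h : ρ ∈ sepCone m n) : (c : ℂ) • ρ ∈ sepCone m n := by
  induction h using AddSubmonoid.closure_induction with
  | mem _ h =>
    obtain ⟨A, B, hA, hB, rfl⟩ := h
    rw [← Matrix.smul_kronecker]
    exact kronecker_mem_sepCone (hA.smul (by exact_mod_cast hc)) hB
  | zero => simp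
  | add _ _ _ _ h1 h2 =>
    rw [smul_add]
    exact add_mem h1 h2

theorem posSemidef_of_mem_sepCone [Finite m] [Finite n] {ρ : Matrix (m × n) (m × n) ℂ}
    (h : ρ ∈ sepCone m n) : ρ.PosSemidef := by
  induction h using AddSubmonoid.closure_induction with
  | mem _ h =>
    obtain ⟨A, B, hA, hB, rfl⟩ := h
    exact hA.kronecker hB
  | zero => exact Matrix.PosSemidef.zero
  | add _ _ _ _ h1 h2 => exact h1.add h2

/-- A nonzero positive operator is a positive multiple of a state. -/
theorem exists_state_of_posSemidef [Fintype m] {A : Matrix m m ℂ} (hA : A.PosSemidef)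
    (h0 : A ≠ 0) : ∃ (w : ℝ) (σ : Matrix m m ℂ), 0 ≤ w ∧ IsState σ ∧ A = (w : ℂ) • σ := by
  have hne : A.trace ≠ 0 := fun h => h0 (hA.trace_eq_zero_iff.1 h)
  obtain ⟨w, hw, hwA⟩ := RCLike.nonneg_iff_exists_ofReal.1 hA.trace_nonneg
  change (w : ℂ) = A.trace at hwA
  rw [← hwA] at hne
  refine ⟨w, ((w⁻¹ : ℝ) : ℂ) • A, hw, ⟨hA.smul (by exact_mod_cast inv_nonneg.2 hw), ?_⟩, ?_⟩
  · rw [Matrix.trace_smul, ← hwA, smul_eq_mul, Complex.ofReal_inv, inv_mul_cancel₀ hne]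
  · rw [smul_smul, Complex.ofReal_inv, mul_inv_cancel₀ hne, one_smul]

theorem exists_sum_of_mem_sepCone [Fintype m] [Fintype n] {ρ : Matrix (m × n) (m × n) ℂ}
    (h : ρ ∈ sepCone m n) :
    ∃ (r : ℕ) (w : Fin r → ℝ) (σ : Fin r → Matrix m m ℂ) (τ : Fin r → Matrix n n ℂ),
      (∀ j, 0 ≤ w j) ∧ (∀ j, IsState (σ j)) ∧ (∀ j, IsState (τ j)) ∧
        ρ = ∑ j, (w j : ℂ) • (σ j ⊗ₖ τ j) := by
  have zero : ∃ (r : ℕ) (w : Fin r → ℝ) (σ : Fin r → Matrix m m ℂ) (τ : Fin r → Matrix n n ℂ),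
      (∀ j, 0 ≤ w j) ∧ (∀ j, IsState (σ j)) ∧ (∀ j, IsState (τ j)) ∧
        (0 : Matrix (m × n) (m × n) ℂ) = ∑ j, (w j : ℂ) • (σ j ⊗ₖ τ j) :=
    ⟨0, Fin.elim0, Fin.elim0, Fin.elim0, fun j => j.elim0, fun j => j.elim0, fun j => j.elim0,
      by simp⟩
  induction h using AddSubmonoid.closure_induction with
  | mem _ h =>
    obtain ⟨A, B, hA, hB, rfl⟩ := h
    rcases eq_or_ne A 0 with rfl | hA0
    · simpa using zero
    rcases eq_or_ne B 0 with rfl | hB0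
    · simpa using zero
    obtain ⟨u, σ, hu, hσ, rfl⟩ := exists_state_of_posSemidef hA hA0
    obtain ⟨v, τ, hv, hτ, rfl⟩ := exists_state_of_posSemidef hB hB0
    refine ⟨1, fun _ => u * v, fun _ => σ, fun _ => τ, fun _ => mul_nonneg hu hv, fun _ => hσ,
      fun _ => hτ, ?_⟩
    rw [Finset.univ_unique, Finset.sum_singleton, Matrix.smul_kronecker, Matrix.kronecker_smul,
      smul_smul, Complex.ofReal_mul]
  | zero => exact zero
  | add _ _ _ _ h1 h2 =>
    obtain ⟨r, w, σ, τ, hw, hσ, hτ, rfl⟩ := h1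
    obtain ⟨r', w', σ', τ', hw', hσ', hτ', rfl⟩ := h2
    refine ⟨r + r', Fin.append w w', Fin.append σ σ', Fin.append τ τ', fun j => ?_, fun j => ?_,
      fun j => ?_, by simp [Fin.sum_univ_add]⟩ <;>
    refine Fin.addCases (fun i => ?_) (fun i => ?_) j <;> simp [*]

theorem isSeparable_of_mem_sepCone [Fintype m] [Fintype n] {ρ : Matrix (m × n) (m × n) ℂ}
    (h : ρ ∈ sepCone m n) (htr : ρ.trace = 1) : IsSeparable ρ := by
  obtain ⟨r, w, σ, τ, hw, hσ, hτ, rfl⟩ := exists_sum_of_mem_sepCone h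
  refine ⟨r, w, σ, τ, hw, ?_, hσ, hτ, rfl⟩
  simp only [Matrix.trace_sum, Matrix.trace_smul, Matrix.trace_kronecker, (hσ _).2, (hτ _).2,
    mul_one, smul_eq_mul] at htr
  exact_mod_cast htr

/-! ### Measure-and-prepare maps -/

/-- The map `X ↦ (v† X v) v v†`, which measures along `v` and prepares `v`. -/
def measurePrepare [Fintype m] (v : m → ℂ) : Superop m m :=
  conjMap (Matrix.vecMulVec v (star v))

theorem measurePrepare_apply [Fintype m] (v : m → ℂ) (X : Matrix m m ℂ) (i j : m) :
    measurePrepare v X i j = ∑ l, ∑ k, X k l * (v i * star (v j) * star (v k) * v l) := by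
  simp only [measurePrepare, conjMap_apply, Matrix.mul_apply, Matrix.conjTranspose_apply,
    Matrix.vecMulVec_apply, Pi.star_apply, star_mul', star_star, Finset.sum_mul]
  exact Finset.sum_congr rfl fun _ _ => Finset.sum_congr rfl fun _ _ => by ring

/-- Superoperators which, applied to either factor, send positive operators to separable ones. -/
def IsDisentangling (Φ : Superop m m) : Prop :=
  ∀ (k : ℕ), (∀ ω : Matrix (m × Fin k) (m × Fin k) ℂ, ω.PosSemidef →
      tensorId Φ (Fin k) ω ∈ sepCone m (Fin k)) ∧
    ∀ ω : Matrix (Fin k × m) (Fin k × m) ℂ, ω.PosSemidef →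
      idTensor (Fin k) Φ ω ∈ sepCone (Fin k) m

theorem IsDisentangling.zero : IsDisentangling (0 : Superop m m) :=
  fun _ => ⟨fun _ _ => zero_mem _, fun _ _ => zero_mem _⟩

theorem IsDisentangling.add {Φ Ψ : Superop m m} (h : IsDisentangling Φ) (h' : IsDisentangling Ψ) :
    IsDisentangling (Φ + Ψ) := fun k =>
  ⟨fun ω hω => add_mem ((h k).1 ω hω) ((h' k).1 ω hω),
    fun ω hω => add_mem ((h k).2 ω hω) ((h' k).2 ω hω)⟩

theorem IsDisentangling.sum {ι : Type*} (s : Finset ι) {Φ : ι → Superop m m}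
    (h : ∀ i ∈ s, IsDisentangling (Φ i)) : IsDisentangling (∑ i ∈ s, Φ i) :=
  Finset.sum_induction _ _ (fun _ _ => IsDisentangling.add) IsDisentangling.zero h

theorem IsDisentangling.smul {Φ : Superop m m} {c : ℝ} (hc : 0 ≤ c) (h : IsDisentangling Φ) :
    IsDisentangling ((c : ℂ) • Φ) := fun k =>
  ⟨fun ω hω => smul_mem_sepCone hc ((h k).1 ω hω), fun ω hω => smul_mem_sepCone hc ((h k).2 ω hω)⟩

theorem isDisentangling_measurePrepare [Fintype m] (v : m → ℂ) :
    IsDisentangling (measurePrepare v) := by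
  classical
  refine fun k => ⟨fun ω hω => ?_, fun ω hω => ?_⟩
  -- `W` is `v ⊗ 1`, so `W† ω W` is the unnormalized state of the ancilla conditioned on the outcome
  -- `v`.
  · let W : Matrix (m × Fin k) (Fin k) ℂ := Matrix.of fun x b => if x.2 = b then v x.1 else 0
    have : tensorId (measurePrepare v) (Fin k) ω =
        Matrix.vecMulVec v (star v) ⊗ₖ (W.conjTranspose * ω * W) := by
      ext x y
      change measurePrepare v (Matrix.of fun i j => ω (i, x.2) (j, y.2)) x.1 y.1 = _
      simp [measurePrepare_apply, W, Matrix.mul_apply,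
        Matrix.vecMulVec_apply, Fintype.sum_prod_type, apply_ite, Finset.mul_sum, Finset.sum_mul]
      refine Finset.sum_congr rfl fun _ _ => Finset.sum_congr rfl fun _ _ => by ring
    rw [this]
    exact kronecker_mem_sepCone (Matrix.posSemidef_vecMulVec_self_star v)
      (hω.conjTranspose_mul_mul_same W)
  · let W : Matrix (Fin k × m) (Fin k) ℂ := Matrix.of fun x b => if x.1 = b then v x.2 else 0
    have : idTensor (Fin k) (measurePrepare v) ω =
        (W.conjTranspose * ω * W) ⊗ₖ Matrix.vecMulVec v (star v) := by
      ext x y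
      change measurePrepare v (Matrix.of fun i j => ω (x.1, i) (y.1, j)) x.2 y.2 = _
      simp [measurePrepare_apply, W, Matrix.mul_apply,
        Matrix.vecMulVec_apply, Fintype.sum_prod_type_right, apply_ite,
        Finset.sum_mul]
      refine Finset.sum_congr rfl fun _ _ => Finset.sum_congr rfl fun _ _ => by ring
    rw [this]
    exact kronecker_mem_sepCone (hω.conjTranspose_mul_mul_same W)
      (Matrix.posSemidef_vecMulVec_self_star v)

/-! ### Powers of two as a Sidon set, and the decomposition of `Id + tr(·) I` -/

/-- Sums of two powers of two determine the exponents: the case of an odd summand. -/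
theorem one_add_two_pow_eq {l j k : ℕ} (h : 1 + 2 ^ l = 2 ^ j + 2 ^ k) :
    (0 = j ∧ l = k) ∨ (0 = k ∧ l = j) := by
  have inj := @Nat.pow_right_injective 2 le_rfl
  have hl := Nat.one_le_two_pow (n := l)
  rcases j with _ | j
  · exact Or.inl ⟨rfl, inj (by simpa using h)⟩
  rcases k with _ | k
  · exact Or.inr ⟨rfl, inj (by simp only [pow_zero] at h ⊢; omega)⟩
  have hj := Nat.one_le_two_pow (n := j)
  have hk := Nat.one_le_two_pow (n := k)
  rcases l with _ | l <;> simp only [pow_succ, pow_zero] at h <;> omega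

/-- Sums of two powers of two determine the exponents. -/
theorem two_pow_add_two_pow_eq {i l j k : ℕ} (h : 2 ^ i + 2 ^ l = 2 ^ j + 2 ^ k) :
    (i = j ∧ l = k) ∨ (i = k ∧ l = j) := by
  induction i generalizing l j k with
  | zero => exact one_add_two_pow_eq (by simpa using h)
  | succ i ih =>
    rcases l with _ | l
    · have := one_add_two_pow_eq (l := i + 1) (j := j) (k := k) (by rw [← h]; ring)
      tauto
    rcases j with _ | j
    · have := one_add_two_pow_eq (l := k) (j := i + 1) (k := l + 1) (by simpa using h.symm)
      omega
    rcases k with _ | k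
    · have := one_add_two_pow_eq (l := j + 1) (j := i + 1) (k := l + 1) (by rw [h]; ring)
      omega
    have := ih (l := l) (j := j) (k := k) (by simp only [pow_succ] at h; omega)
    omega

/-- The vector of characters `x ↦ ψ (x 2ʲ)`, where `ψ` generates the dual of `ℤ / 2ᵈ⁺¹`. -/
def phaseVector (d : ℕ) (x : ZMod (2 ^ (d + 1))) (j : Fin d) : ℂ :=
  ZMod.stdAddChar (x * ((2 ^ (j : ℕ) : ℕ) : ZMod (2 ^ (d + 1))))

/-- Orthogonality of characters leaves only the solutions of `2^i + 2^l = 2^j + 2^k` modulo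
`2^(d+1)`, and these are the trivial ones. -/
theorem sum_phaseVector (d : ℕ) (i j k l : Fin d) :
    ∑ x, phaseVector d x i * star (phaseVector d x j) * star (phaseVector d x k) *
      phaseVector d x l =
    if (i = j ∧ l = k) ∨ (i = k ∧ l = j) then (2 : ℂ) ^ (d + 1) else 0 := by
  set s : Fin d → ZMod (2 ^ (d + 1)) := fun j => ((2 ^ (j : ℕ) : ℕ) : ZMod (2 ^ (d + 1)))
  have h1 : ∀ x, phaseVector d x i * star (phaseVector d x j) * star (phaseVector d x k) *
      phaseVector d x l = ZMod.stdAddChar (x * (s i + s l - (s j + s k))) := fun x => by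
    simp only [phaseVector, RCLike.star_def, ← AddChar.map_neg_eq_conj, ← AddChar.map_add_eq_mul]
    congr 1
    ring
  have h2 : s i + s l - (s j + s k) = 0 ↔ (i = j ∧ l = k) ∨ (i = k ∧ l = j) := by
    rw [sub_eq_zero]
    constructor
    · intro h
      simp only [s, ← Nat.cast_add] at h
      -- The modulus is large enough that sums of two of these powers do not wrap around, so the
      -- congruence is an equality of naturals.
      have lt : ∀ a b : Fin d, 2 ^ (a : ℕ) + 2 ^ (b : ℕ) < 2 ^ (d + 1) := fun a b => by
        have ha := Nat.pow_lt_pow_right one_lt_two a.2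
        have hb := Nat.pow_lt_pow_right one_lt_two b.2
        rw [pow_succ]
        omega
      rw [ZMod.natCast_eq_natCast_iff', Nat.mod_eq_of_lt (lt _ _), Nat.mod_eq_of_lt (lt _ _)] at h
      simpa only [Fin.ext_iff] using two_pow_add_two_pow_eq h
    · rintro (⟨rfl, rfl⟩ | ⟨rfl, rfl⟩)
      · rfl
      · exact add_comm _ _
  simp only [h1, AddChar.sum_mulShift _ (ZMod.isPrimitive_stdAddChar _), h2, ZMod.card]
  push_cast
  rfl

/-- Averaging over the phase vectors produces `X + tr(X) I - diag(X)`: the two pairings of indices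
overlap on the diagonal. Measuring in the standard basis restores `diag(X)`. -/
theorem sum_measurePrepare_phaseVector (d : ℕ) :
    (((2 ^ (d + 1))⁻¹ : ℝ) : ℂ) • ∑ x, measurePrepare (phaseVector d x) +
      ∑ i, measurePrepare (Pi.single i 1) = LinearMap.id + traceOne (Fin d) := by
  ext1 X
  ext i j
  have h1 : (∑ i, measurePrepare (Pi.single i 1)) X i j = if i = j then X i j else 0 := by
    simp [LinearMap.sum_apply, Matrix.sum_apply, measurePrepare_apply, Pi.single_apply]
    split_ifs with h
    · rw [h]
    · rfl
  have h2 : (∑ x, measurePrepare (phaseVector d x)) X i j = (2 : ℂ) ^ (d + 1) *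
      (X i j + (if i = j then X.trace else 0) - if i = j then X i j else 0) := by
    simp only [LinearMap.sum_apply, Matrix.sum_apply, measurePrepare_apply]
    rw [Finset.sum_comm]
    simp_rw [Finset.sum_comm (s := (Finset.univ : Finset (ZMod _))), ← Finset.mul_sum,
      sum_phaseVector]
    by_cases hij : i = j
    · subst hij
      have : ∀ l k : Fin d, (True ∧ l = k ∨ i = k ∧ l = i) ↔ l = k := fun l k =>
        ⟨fun h => h.elim And.right fun h => h.2.trans h.1, fun h => Or.inl ⟨trivial, h⟩⟩
      simp only [this]
      simp [Matrix.trace, Finset.mul_sum, mul_comm]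
    · simp [hij, ite_and, mul_comm]
  rw [LinearMap.add_apply, Matrix.add_apply, h1, LinearMap.smul_apply, Matrix.smul_apply, h2]
  simp [traceOne_apply, Matrix.one_apply]

theorem depolarizing_inv_add_one (d : ℕ) (hd : d ≠ 0) :
    depolarizing (Fin d) (1 / (d + 1)) =
      ((1 / (d + 1) : ℝ) : ℂ) • (LinearMap.id + traceOne (Fin d)) := by
  rw [depolarizing_eq, smul_add]
  congr 3
  have : (d : ℝ) ≠ 0 := by exact_mod_cast hd
  rw [Fintype.card_fin]
  field_simp
  ring

theorem isDisentangling_depolarizing (d : ℕ) (hd : d ≠ 0) :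
    IsDisentangling (depolarizing (Fin d) (1 / (d + 1))) := by
  rw [depolarizing_inv_add_one d hd, ← sum_measurePrepare_phaseVector]
  refine .smul (by positivity) (.add (.smul (by positivity) (.sum _ fun x _ => ?_))
    (.sum _ fun i _ => ?_)) <;>
  exact isDisentangling_measurePrepare _

theorem IsDisentangling.isEntanglementBreaking [Fintype m] {Φ : Superop m m}
    (h : IsDisentangling Φ) (htr : ∀ X, (Φ X).trace = X.trace) : IsEntanglementBreaking Φ := by
  refine ⟨⟨fun k ω hω => posSemidef_of_mem_sepCone ((h k).1 ω hω), htr⟩, fun k ω hω =>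
    isSeparable_of_mem_sepCone ((h k).1 ω hω.1) ?_⟩
  rw [← hω.2]
  simp only [Matrix.trace, Fintype.sum_prod_type_right, Matrix.diag_apply]
  refine Finset.sum_congr rfl fun b _ => ?_
  exact htr (Matrix.of fun i j => ω (i, b) (j, b))

theorem isEntanglementBreaking_depolarizing (d : ℕ) (hd : d ≠ 0) :
    IsEntanglementBreaking (depolarizing (Fin d) (1 / (d + 1))) :=
  have : Nonempty (Fin d) := ⟨⟨0, Nat.pos_of_ne_zero hd⟩⟩
  (isDisentangling_depolarizing d hd).isEntanglementBreaking (depolarizing_trace _)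

/-! ### Positivity of `Λ_{st}` -/

theorem sub_kronecker (X X' : Matrix m m ℂ) (Y : Matrix n n ℂ) :
    (X - X') ⊗ₖ Y = X ⊗ₖ Y - X' ⊗ₖ Y := by
  ext
  simp [sub_mul]

theorem kronecker_sub (X : Matrix m m ℂ) (Y Y' : Matrix n n ℂ) :
    X ⊗ₖ (Y - Y') = X ⊗ₖ Y - X ⊗ₖ Y' := by
  ext
  simp [mul_sub]

theorem lambdaMap_kronecker [Fintype m] [DecidableEq m] [Fintype n] [DecidableEq n]
    (s t : ℝ) (X : Matrix m m ℂ) (Y : Matrix n n ℂ) :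
    lambdaMap m n s t (X ⊗ₖ Y) = (t : ℂ) • (X ⊗ₖ Y) +
      ((s - t) / Fintype.card m * X.trace : ℂ) • (1 ⊗ₖ Y) +
      ((s - t) / Fintype.card n * Y.trace : ℂ) • (X ⊗ₖ 1) +
      ((1 - 2 * s + t) / (Fintype.card m * Fintype.card n) * (X.trace * Y.trace) : ℂ) •
        ((1 : Matrix m m ℂ) ⊗ₖ (1 : Matrix n n ℂ)) := by
  have e1 : traceMap m X = (X.trace / Fintype.card m) • 1 := by
    simp [traceMap, smul_smul, div_eq_mul_inv]
  have e2 : traceMap n Y = (Y.trace / Fintype.card n) • 1 := by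
    simp [traceMap, smul_smul, div_eq_mul_inv]
  simp only [lambdaMap, LinearMap.add_apply, LinearMap.smul_apply, LinearMap.comp_apply,
    LinearMap.sub_apply, LinearMap.id_apply, tensorId_kronecker, idTensor_kronecker, e1, e2,
    sub_kronecker, kronecker_sub, map_sub, map_smul,
    Matrix.smul_kronecker, Matrix.kronecker_smul, div_eq_mul_inv, mul_inv]
  module

theorem traceOne_prod_kronecker [Fintype m] [DecidableEq m] [Fintype n] [DecidableEq n]
    (X : Matrix m m ℂ) (Y : Matrix n n ℂ) : traceOne (m × n) (X ⊗ₖ Y) =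
      (X.trace * Y.trace) • ((1 : Matrix m m ℂ) ⊗ₖ (1 : Matrix n n ℂ)) := by
  rw [traceOne_apply, Matrix.trace_kronecker, Matrix.one_kronecker_one]

/-- The double reduction map, written as a positive map after the full transposition. -/
theorem doubleReduction_kronecker [Fintype m] [DecidableEq m] [Fintype n] [DecidableEq n]
    (X : Matrix m m ℂ) (Y : Matrix n n ℂ) :
    tensorId (wernerHolevo m) n (idTensor m (wernerHolevo n) (X ⊗ₖ Y).transpose) =
      X ⊗ₖ Y - X.trace • (1 ⊗ₖ Y) - Y.trace • (X ⊗ₖ 1) +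
      (X.trace * Y.trace) • ((1 : Matrix m m ℂ) ⊗ₖ (1 : Matrix n n ℂ)) := by
  rw [← Matrix.kroneckerMap_transpose, idTensor_kronecker, tensorId_kronecker]
  simp only [wernerHolevo_apply, Matrix.trace_transpose, Matrix.transpose_transpose,
    sub_kronecker, kronecker_sub, Matrix.smul_kronecker, Matrix.kronecker_smul]
  module

theorem isPositiveMap_lambdaMap_of_nonneg (d : ℕ) (hd : 2 ≤ d) {s : ℝ} (h0 : 0 ≤ s)
    (h1 : s ≤ 2 / ((d : ℝ) ^ 2 - d + 2)) :
    IsPositiveMap (lambdaMap (Fin d) (Fin d) s ((d + 2) / 2 * s)) := by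
  have hd' : (2 : ℝ) ≤ d := by exact_mod_cast hd
  have hdC : (d : ℂ) ≠ 0 := by exact_mod_cast (by omega : d ≠ 0)
  -- The terms `tr_A` and `tr_B` have coefficient `(s - t)/d = -s/2`, which fixes the weight of the
  -- double reduction; the other two weights follow.
  have key : lambdaMap (Fin d) (Fin d) s ((d + 2) / 2 * s) =
      ((s / 2 : ℝ) : ℂ) • (tensorId (wernerHolevo (Fin d)) (Fin d) ∘ₗ
        idTensor (Fin d) (wernerHolevo (Fin d)) ∘ₗ
        (Matrix.transposeLinearEquiv _ _ ℂ ℂ).toLinearMap) +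
      ((s * (d + 1) / 2 : ℝ) : ℂ) • LinearMap.id +
      (((1 + s * (d - 2) / 2) / d ^ 2 - s / 2 : ℝ) : ℂ) • traceOne (Fin d × Fin d) := by
    refine superop_ext fun X Y => ?_
    have h : (tensorId (wernerHolevo (Fin d)) (Fin d) ∘ₗ
        idTensor (Fin d) (wernerHolevo (Fin d)) ∘ₗ
        (Matrix.transposeLinearEquiv _ _ ℂ ℂ).toLinearMap) (X ⊗ₖ Y) = _ :=
      doubleReduction_kronecker X Y
    rw [LinearMap.add_apply, LinearMap.add_apply, LinearMap.smul_apply, h]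
    simp only [LinearMap.smul_apply, LinearMap.id_apply, traceOne_prod_kronecker,
      lambdaMap_kronecker, Fintype.card_fin]
    push_cast
    match_scalars <;> field_simp <;> ring
  rw [key]
  intro ρ hρ
  have hS : ∀ {x : ℝ}, 0 ≤ x → (0 : ℂ) ≤ x := fun h => by exact_mod_cast h
  rw [LinearMap.add_apply, LinearMap.add_apply, LinearMap.smul_apply, LinearMap.smul_apply,
    LinearMap.smul_apply]
  refine .add (.add (.smul ?_ (hS (by positivity))) (.smul hρ (hS (by positivity))))
    (.smul (isPositiveMap_of_mem_krausCone traceOne_mem_krausCone ρ hρ) (hS ?_))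
  · rw [LinearMap.comp_apply, LinearMap.comp_apply]
    exact isPositiveMap_of_mem_krausCone (tensorId_mem_krausCone wernerHolevo_mem_krausCone) _
      (isPositiveMap_of_mem_krausCone (idTensor_mem_krausCone wernerHolevo_mem_krausCone) _
        hρ.transpose)
  -- The trace coefficient is nonnegative if and only if `s (d² - d + 2) ≤ 2`.
  · rw [le_div_iff₀ (by nlinarith)] at h1
    rw [sub_nonneg, le_div_iff₀ (by positivity)]
    nlinarith

theorem traceOne_sub_id_posSemidef [Fintype n] [DecidableEq n] {ρ : Matrix n n ℂ}
    (hρ : ρ.PosSemidef) : (traceOne n ρ - ρ).PosSemidef := by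
  have := isPositiveMap_of_mem_krausCone wernerHolevo_mem_krausCone _ hρ.transpose
  simpa [wernerHolevo_apply, traceOne_apply] using this

theorem isPositiveMap_lambdaMap_of_nonpos (d : ℕ) (hd : 2 ≤ d) {r : ℝ} (h0 : 0 ≤ r)
    (h1 : r * (((d : ℝ) + 2) * (d - 1) * (d ^ 2 + 1)) ≤ 2) :
    IsPositiveMap (lambdaMap (Fin d) (Fin d) (-r) ((d + 2) / 2 * (-r))) := by
  have hd' : (2 : ℝ) ≤ d := by exact_mod_cast hd
  have hdC : (d : ℂ) ≠ 0 := by exact_mod_cast (by omega : d ≠ 0)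
  -- Now `(s - t)/d = r/2` is nonnegative, so partial traces serve in place of the double reduction,
  -- and `tr(ρ) I - ρ ≥ 0` handles the negative multiple of the identity map.
  have key : lambdaMap (Fin d) (Fin d) (-r) ((d + 2) / 2 * (-r)) =
      (((d + 2) / 2 * r : ℝ) : ℂ) • (traceOne (Fin d × Fin d) - LinearMap.id) +
      ((r / 2 : ℝ) : ℂ) • (tensorId (traceOne (Fin d)) (Fin d) +
        idTensor (Fin d) (traceOne (Fin d))) +
      (((1 - r * (d - 2) / 2) / d ^ 2 - (d + 2) / 2 * r : ℝ) : ℂ) •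
        traceOne (Fin d × Fin d) := by
    refine superop_ext fun X Y => ?_
    simp only [LinearMap.add_apply, LinearMap.smul_apply, LinearMap.sub_apply,
      LinearMap.id_apply, traceOne_prod_kronecker, lambdaMap_kronecker, tensorId_kronecker,
      idTensor_kronecker, Fintype.card_fin, traceOne_apply (n := Fin d), Matrix.smul_kronecker,
      Matrix.kronecker_smul]
    push_cast
    match_scalars <;> field_simp <;> ring
  rw [key]
  intro ρ hρ
  have hS : ∀ {x : ℝ}, 0 ≤ x → (0 : ℂ) ≤ x := fun h => by exact_mod_cast h
  refine .add (.add (.smul (traceOne_sub_id_posSemidef hρ) (hS (by positivity)))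
    (.smul (.add ?_ ?_) (hS (by positivity))))
    (.smul (isPositiveMap_of_mem_krausCone traceOne_mem_krausCone ρ hρ) (hS ?_))
  · exact isPositiveMap_of_mem_krausCone (tensorId_mem_krausCone traceOne_mem_krausCone) _ hρ
  · exact isPositiveMap_of_mem_krausCone (idTensor_mem_krausCone traceOne_mem_krausCone) _ hρ
  -- The trace coefficient only needs `r (d³ + 2d² + d - 2) ≤ 2`; the hypothesis is stronger by `r
  -- d² (d² - 3)`.
  · have h2 : (d : ℝ) ^ 3 + 2 * d ^ 2 + d - 2 ≤ ((d : ℝ) + 2) * (d - 1) * (d ^ 2 + 1) := by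
      have : 0 ≤ (d : ℝ) ^ 2 * ((d : ℝ) ^ 2 - 3) := mul_nonneg (by positivity) (by nlinarith)
      nlinarith
    have h3 := mul_le_mul_of_nonneg_left h2 h0
    rw [sub_nonneg, le_div_iff₀ (by positivity)]
    nlinarith

/-! ### The resolution and its parameters -/

theorem depolarizing_eq_resolutionMap (d : ℕ) (hd : d ≠ 0) (q s : ℝ)
    (hq : q = ((d : ℝ) + 2) / (2 * (d + 1)) * s) :
    depolarizing (Fin d × Fin d) q = resolutionMap d (1 / (d + 1)) s ((d + 2) / 2 * s) := by
  have hdC : (d : ℂ) ≠ 0 := by exact_mod_cast hd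
  have hdC' : (d : ℂ) + 1 ≠ 0 := by exact_mod_cast d.succ_ne_zero
  subst hq
  refine superop_ext fun X Y => ?_
  simp only [resolutionMap, depolarizing_eq, LinearMap.add_apply, LinearMap.smul_apply,
    LinearMap.comp_apply, LinearMap.id_apply, traceOne_prod_kronecker, lambdaMap_kronecker,
    tensorId_kronecker, idTensor_kronecker, Fintype.card_fin, Fintype.card_prod,
    traceOne_apply (n := Fin d), Matrix.smul_kronecker, Matrix.kronecker_smul, map_add, map_smul, Matrix.add_kronecker,
    Matrix.kronecker_add, Matrix.trace_one]
  push_cast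
  match_scalars <;> field_simp <;> ring

theorem mem_sepCone_resolutionMap (d : ℕ) (hd : d ≠ 0) {s t : ℝ}
    (h : IsPositiveMap (lambdaMap (Fin d) (Fin d) s t)) {ρ : Matrix (Fin d × Fin d) _ ℂ}
    (hρ : ρ.PosSemidef) : resolutionMap d (1 / (d + 1)) s t ρ ∈ sepCone (Fin d) (Fin d) := by
  have hΦ := isDisentangling_depolarizing d hd d
  exact smul_mem_sepCone (by norm_num) (add_mem (hΦ.1 _ (h ρ hρ)) (hΦ.2 _ (h ρ hρ)))

theorem globalThreshold_pos (d : ℕ) : 0 < globalThreshold d := by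
  unfold globalThreshold
  have : (0 : ℝ) < (d : ℝ) ^ 2 - d + 2 := by nlinarith [sq_nonneg ((d : ℝ) - 1)]
  positivity

theorem globalThreshold_le_one (d : ℕ) : globalThreshold d ≤ 1 := by
  unfold globalThreshold
  have h : (0 : ℝ) < (d : ℝ) ^ 2 - d + 2 := by nlinarith [sq_nonneg ((d : ℝ) - 1)]
  rw [div_le_one (by positivity)]
  have : (0 : ℝ) ≤ d * d ^ 2 := by positivity
  nlinarith

theorem resolution_parameter (d : ℕ) (q : ℝ) :
    q / globalThreshold d * (2 / ((d : ℝ) ^ 2 - d + 2)) = 2 * (d + 1) / (d + 2) * q := by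
  have h : (d : ℝ) ^ 2 - d + 2 ≠ 0 := by nlinarith [sq_nonneg ((d : ℝ) - 1)]
  have h2 : (d : ℝ) + 2 ≠ 0 := by positivity
  have h3 : (d : ℝ) + 1 ≠ 0 := by positivity
  unfold globalThreshold
  -- This factor cancels, so `s` is linear in `q` with slope `2(d+1)/(d+2)`; only its being nonzero
  -- matters.
  generalize (d : ℝ) ^ 2 - d + 2 = c at h ⊢
  field_simp

theorem isPositiveMap_lambdaMap (d : ℕ) (hd : 2 ≤ d) {q : ℝ} (h0 : -1 / ((d : ℝ) ^ 4 - 1) ≤ q)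
    (h1 : q ≤ globalThreshold d) :
    IsPositiveMap (lambdaMap (Fin d) (Fin d) (2 * (d + 1) / (d + 2) * q)
      ((d + 2) / 2 * (2 * (d + 1) / (d + 2) * q))) := by
  have hd' : (2 : ℝ) ≤ d := by exact_mod_cast hd
  rcases le_total 0 q with hq | hq
  · refine isPositiveMap_lambdaMap_of_nonneg d hd (by positivity) ?_
    rw [← resolution_parameter]
    have h : (0 : ℝ) < (d : ℝ) ^ 2 - d + 2 := by nlinarith
    exact mul_le_of_le_one_left (by positivity) ((div_le_one (globalThreshold_pos d)).2 h1)
  · have := isPositiveMap_lambdaMap_of_nonpos d hd (r := 2 * (d + 1) / (d + 2) * (-q))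
      (mul_nonneg (by positivity) (by linarith)) ?_
    · simpa only [mul_neg, neg_neg] using this
    · have h4 : (0 : ℝ) < (d : ℝ) ^ 4 - 1 := by
        have : (d : ℝ) ^ 4 - 1 = ((d : ℝ) - 1) * (d + 1) * (d ^ 2 + 1) := by ring
        rw [this]
        have : (0 : ℝ) < (d : ℝ) - 1 := by linarith
        positivity
      rw [div_le_iff₀ h4] at h0
      -- By `d⁴ - 1 = (d - 1)(d + 1)(d² + 1)`, the bound required of `r` is exactly the lower bound
      -- on `q`.
      have : 2 * ((d : ℝ) + 1) / (d + 2) * (-q) * ((d + 2) * (d - 1) * (d ^ 2 + 1)) =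
          2 * (-q * (d ^ 4 - 1)) := by
        field_simp
        ring
      rw [this]
      linarith

end EAChannel

end

theorem mainTheorem6 (d : ℕ) (hd : 2 ≤ d) :
    -- every global depolarizing channel with `q` at most the threshold
    (∀ q : ℝ, -1 / ((d : ℝ) ^ 4 - 1) ≤ q → q ≤ EAChannel.globalThreshold d →
      EAChannel.IsEntanglementAnnihilating
        (EAChannel.depolarizing (Fin d × Fin d) q) ∧
      ∀ p s t : ℝ, p = 1 / ((d : ℝ) + 1) →
        s = q / EAChannel.globalThreshold d * (2 / ((d : ℝ) ^ 2 - d + 2)) →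
        t = ((d : ℝ) + 2) / 2 * s →
        EAChannel.IsEntanglementBreaking (EAChannel.depolarizing (Fin d) p) ∧
        EAChannel.IsPositiveMap (EAChannel.lambdaMap (Fin d) (Fin d) s t) ∧
        EAChannel.depolarizing (Fin d × Fin d) q = EAChannel.resolutionMap d p s t) ∧
    -- the resolution at the threshold itself
    (∀ p s t : ℝ, p = 1 / ((d : ℝ) + 1) → s = 2 / ((d : ℝ) ^ 2 - d + 2) →
      t = ((d : ℝ) + 2) / 2 * s →
      EAChannel.IsEntanglementBreaking (EAChannel.depolarizing (Fin d) p) ∧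
      EAChannel.IsPositiveMap (EAChannel.lambdaMap (Fin d) (Fin d) s t) ∧
      EAChannel.depolarizing (Fin d × Fin d) (EAChannel.globalThreshold d) =
        EAChannel.resolutionMap d p s t) := by
  have hd0 : d ≠ 0 := by omega
  have main : ∀ q : ℝ, -1 / ((d : ℝ) ^ 4 - 1) ≤ q → q ≤ EAChannel.globalThreshold d →
      EAChannel.IsEntanglementBreaking (EAChannel.depolarizing (Fin d) (1 / ((d : ℝ) + 1))) ∧
      EAChannel.IsPositiveMap (EAChannel.lambdaMap (Fin d) (Fin d) (2 * (d + 1) / (d + 2) * q)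
        ((d + 2) / 2 * (2 * (d + 1) / (d + 2) * q))) ∧
      EAChannel.depolarizing (Fin d × Fin d) q =
        EAChannel.resolutionMap d (1 / (d + 1)) (2 * (d + 1) / (d + 2) * q)
          ((d + 2) / 2 * (2 * (d + 1) / (d + 2) * q)) := fun q h0 h1 =>
    ⟨EAChannel.isEntanglementBreaking_depolarizing d hd0,
      EAChannel.isPositiveMap_lambdaMap d hd h0 h1,
      EAChannel.depolarizing_eq_resolutionMap d hd0 q _ (by field_simp)⟩
  have hd' : (2 : ℝ) ≤ d := by exact_mod_cast hd
  have : Nontrivial (Fin d) := Fin.nontrivial_iff_two_le.2 hd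
  refine ⟨fun q h0 h1 => ⟨⟨EAChannel.isChannel_depolarizing ?_
    (h1.trans (EAChannel.globalThreshold_le_one d)), fun ρ hρ => ?_⟩, ?_⟩, ?_⟩
  · convert h0 using 3
    rw [Fintype.card_prod, Fintype.card_fin]
    push_cast
    ring
  · refine EAChannel.isSeparable_of_mem_sepCone ?_
      ((EAChannel.depolarizing_trace q ρ).trans hρ.2)
    obtain ⟨-, hΛ, hres⟩ := main q h0 h1
    rw [hres]
    exact EAChannel.mem_sepCone_resolutionMap d hd0 hΛ hρ.1
  · rintro p s t rfl rfl rfl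
    rw [EAChannel.resolution_parameter]
    exact main q h0 h1
  · rintro p s t rfl hs rfl
    have hpos := EAChannel.globalThreshold_pos d
    have hs' : s = 2 * (d + 1) / (d + 2) * EAChannel.globalThreshold d := by
      rw [← EAChannel.resolution_parameter, div_self hpos.ne', one_mul, hs]
    subst hs'
    refine main _ (le_trans (div_nonpos_of_nonpos_of_nonneg (by norm_num) ?_) hpos.le) le_rfl
    have : (1 : ℝ) ≤ (d : ℝ) ^ 4 := one_le_pow₀ (by linarith)
    linarith
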